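/- Let $n\ge 1$, let $\Omega\subset\mathbb R^n$ be a non-empty bounded open set, $0<s<1$, $\delta>0$, and $\Omega_\delta=\Omega+B(0,\delta)$. Let $w_\delta\in C_c^\infty(B(0,\delta))$ be non-negative, radial and radially non-increasing, with constants $a_0>0$ and $0<b_0<1$ such that $0\le w_\delta\le a_0$ and $w_\delta=a_0$ on $B(0,b_0\delta)$. Put \[ \gamma(\sigma)=\frac{\pi^{n/2}2^{\sigma}\Gamma(\sigma/2)}{\Gamma((n-\sigma)/2)},\qquad \rho_\delta(x)=\frac{w_\delta(x)}{\gamma(1-s)\,|x|^{n-1+s}},\qquad c_{n,s}=\frac{n-1+s}{\gamma(1-s)} . \] For $u\in C_c^\infty(\mathbb R^n)$ let \[ D^s_\delta u(x)=c_{n,s}\int_{B(x,\delta)}\frac{u(x)-u(y)}{|x-y|}\,\frac{x-y}{|x-y|}\,\frac{w_\delta(x-y)}{|x-y|^{n-1+s}}\,dy . \] For $u\in L^1(\Omega_\delta)$ put $D^s_\delta u=V$ in $\Omega$ whenever there are $u_j\in C_c^\infty(\mathbb R^n)$ with $u_j\to u$ in $L^1(\Omega_\delta)$ and $D^s_\delta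 u_j\to V$ in $L^1(\Omega,\mathbb R^n)$. For $1\le p<\infty$ let $H^{s,p,\delta}(\Omega)$ be the closure of $C_c^\infty(\mathbb R^n)$ under the norm \[ \|u\|_{H^{s,p,\delta}(\Omega)}=\bigl(\|u\|_{L^p(\Omega_\delta)}^p+\|D^s_\delta u\|_{L^p(\Omega)}^p\bigr)^{1/p}. \] Assume that $\Omega_\delta$ has a Lipschitz boundary. Then: a) For every $1\le p<\infty$, the continuous embedding $W^{1,p}(\Omega_\delta)\subset H^{s,p,\delta}(\Omega)$ holds and, for all $u\in W^{1,p}(\Omega_\delta)$, \[ \|D^s_\delta u\|_{L^p(\Omega)}\le (n-1+s)\,\|\rho_\delta\|_{L^1(\mathbb R^n)}\,\|Du\|_{L^p(\Omega_\delta)} . \] b) For every $1\le p<\infty$, the continuous embedding $W^{1,\infty}(\Omega_\delta)\subset H^{s,p,\delta}(\Omega)$ holds. Moreover, for all $u\in W^{1,\infty}(\Omega_\delta)$, \[ \|D^s_\delta u\|_{L^\infty(\Omega)}\le (n-1+s)\,\|\rho_\delta\|_{L^1(\mathbb R^n)}\,\|Du\|_{L^\infty(\Omega_\delta)} . \] 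-/

import Mathlib

open MeasureTheory Filter Topology
open scoped ENNReal NNReal Pointwise ContDiff InnerProductSpace

noncomputable section

namespace NonlocalGradient

/-- `Ω_δ = Ω + B(0, δ)`. -/
def enlarge {n : ℕ} (δ : ℝ) (Ω : Set (EuclideanSpace ℝ (Fin n))) :
    Set (EuclideanSpace ℝ (Fin n)) :=
  Ω + Metric.ball (0 : EuclideanSpace ℝ (Fin n)) δ

/-- `U` has a Lipschitz boundary: around each of its boundary points, `U` is, in suitable Euclidean
coordinates (vertical direction `e`, horizontal coordinates `y - ⟪e, y⟫ e`), the set of points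
lying strictly above the graph of a Lipschitz function of the horizontal coordinates. -/
def HasLipschitzBoundary {n : ℕ} (U : Set (EuclideanSpace ℝ (Fin n))) : Prop :=
  ∀ x₀ ∈ frontier U, ∃ (e : EuclideanSpace ℝ (Fin n)) (r : ℝ) (K : ℝ≥0)
    (f : EuclideanSpace ℝ (Fin n) → ℝ), ‖e‖ = 1 ∧ 0 < r ∧ LipschitzWith K f ∧
      ∀ y ∈ Metric.ball x₀ r, (y ∈ U ↔ f (y - ⟪e, y⟫_ℝ • e) < ⟪e, y⟫_ℝ)

/-- The assumptions on the cut-off function `w_δ`. -/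
structure IsCutoff {n : ℕ} (δ : ℝ) (w : EuclideanSpace ℝ (Fin n) → ℝ) : Prop where
  nonneg : ∀ x, 0 ≤ w x
  radial : ∀ x y, ‖x‖ = ‖y‖ → w x = w y
  smooth : ContDiff ℝ ∞ w
  hasCompactSupport : HasCompactSupport w
  tsupport_subset : tsupport w ⊆ Metric.ball 0 δ
  plateau : ∃ a₀ b₀ : ℝ, 0 < a₀ ∧ 0 < b₀ ∧ b₀ < 1 ∧ (∀ x, w x ≤ a₀) ∧
    ∀ x ∈ Metric.ball (0 : EuclideanSpace ℝ (Fin n)) (b₀ * δ), w x = a₀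
  antitone : ∀ x y, ‖x‖ ≤ ‖y‖ → w y ≤ w x

/-- The constant `γ(s) = π^{n/2} 2^s Γ(s/2) / Γ((n-s)/2)` in dimension `n`. -/
def gammaConst (n : ℕ) (s : ℝ) : ℝ :=
  Real.pi ^ ((n : ℝ) / 2) * 2 ^ s * Real.Gamma (s / 2) / Real.Gamma (((n : ℝ) - s) / 2)

/-- The kernel `ρ_δ(x) = w_δ(x) / (γ(1-s) |x|^{n-1+s})`. -/
def rho {n : ℕ} (s : ℝ) (w : EuclideanSpace ℝ (Fin n) → ℝ) (x : EuclideanSpace ℝ (Fin n)) : ℝ :=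
  1 / (gammaConst n (1 - s) * ‖x‖ ^ ((n : ℝ) - 1 + s)) * w x

/-- The constant `c_{n,s} = (n-1+s) / γ(1-s)`. -/
def cConst (n : ℕ) (s : ℝ) : ℝ := ((n : ℝ) - 1 + s) / gammaConst n (1 - s)

/-- The nonlocal gradient of a smooth compactly supported function, as a pointwise integral. -/
def smoothGrad {n : ℕ} (s δ : ℝ) (w : EuclideanSpace ℝ (Fin n) → ℝ)
    (u : EuclideanSpace ℝ (Fin n) → ℝ) (x : EuclideanSpace ℝ (Fin n)) :
    EuclideanSpace ℝ (Fin n) :=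
  cConst n s • ∫ y in Metric.ball x δ,
    ((u x - u y) / ‖x - y‖ * (w (x - y) / ‖x - y‖ ^ ((n : ℝ) - 1 + s))) •
      (‖x - y‖⁻¹ • (x - y))

/-- `u ∈ L^q(Ω_δ)`, `V ∈ L^q(Ω, ℝⁿ)`, and there are `u_j ∈ C_c^∞(ℝⁿ)` such that `u_j → u` in
`L^q(Ω_δ)` and the nonlocal gradients of `u_j` converge to `V` in `L^q(Ω, ℝⁿ)`. -/
def IsSmoothLimit {n : ℕ} (s δ : ℝ) (w : EuclideanSpace ℝ (Fin n) → ℝ)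
    (Ω : Set (EuclideanSpace ℝ (Fin n))) (q : ℝ≥0∞) (u : EuclideanSpace ℝ (Fin n) → ℝ)
    (V : EuclideanSpace ℝ (Fin n) → EuclideanSpace ℝ (Fin n)) : Prop :=
  MemLp u q (volume.restrict (enlarge δ Ω)) ∧ MemLp V q (volume.restrict Ω) ∧
    ∃ φ : ℕ → EuclideanSpace ℝ (Fin n) → ℝ,
      (∀ j, ContDiff ℝ ∞ (φ j) ∧ HasCompactSupport (φ j)) ∧
      Tendsto (fun j => eLpNorm (φ j - u) q (volume.restrict (enlarge δ Ω))) atTop (𝓝 0) ∧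
      Tendsto (fun j => eLpNorm (smoothGrad s δ w (φ j) - V) q (volume.restrict Ω)) atTop (𝓝 0)

/-- `V` is (a representative of) the nonlocal gradient `D_δ^s u` in `Ω` of `u ∈ L¹(Ω_δ)`, defined
by approximation in `L¹`. -/
def IsNonlocalGrad {n : ℕ} (s δ : ℝ) (w : EuclideanSpace ℝ (Fin n) → ℝ)
    (Ω : Set (EuclideanSpace ℝ (Fin n))) (u : EuclideanSpace ℝ (Fin n) → ℝ)
    (V : EuclideanSpace ℝ (Fin n) → EuclideanSpace ℝ (Fin n)) : Prop :=
  IsSmoothLimit s δ w Ω 1 u V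

/-- Membership in `H^{s,p,δ}(Ω)`, the closure of `C_c^∞(ℝⁿ)` under the norm
`(‖u‖_{L^p(Ω_δ)}^p + ‖D_δ^s u‖_{L^p(Ω)}^p)^{1/p}`. -/
def MemH {n : ℕ} (s δ : ℝ) (w : EuclideanSpace ℝ (Fin n) → ℝ)
    (Ω : Set (EuclideanSpace ℝ (Fin n))) (p : ℝ≥0∞) (u : EuclideanSpace ℝ (Fin n) → ℝ) : Prop :=
  ∃ V, IsSmoothLimit s δ w Ω p u V

/-- The norm of `H^{s,p,δ}(Ω)`, `1 ≤ p < ∞`, for a function `u` whose nonlocal gradient is `V`. -/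
def hNorm {n : ℕ} (δ : ℝ) (Ω : Set (EuclideanSpace ℝ (Fin n))) (p : ℝ≥0∞)
    (u : EuclideanSpace ℝ (Fin n) → ℝ)
    (V : EuclideanSpace ℝ (Fin n) → EuclideanSpace ℝ (Fin n)) : ℝ≥0∞ :=
  (eLpNorm u p (volume.restrict (enlarge δ Ω)) ^ p.toReal +
    eLpNorm V p (volume.restrict Ω) ^ p.toReal) ^ (1 / p.toReal)

/-- `u ∈ W^{1,p}(U)` with weak gradient `Du = G`. -/
def MemW {n : ℕ} (p : ℝ≥0∞) (U : Set (EuclideanSpace ℝ (Fin n)))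
    (u : EuclideanSpace ℝ (Fin n) → ℝ)
    (G : EuclideanSpace ℝ (Fin n) → EuclideanSpace ℝ (Fin n)) : Prop :=
  MemLp u p (volume.restrict U) ∧ MemLp G p (volume.restrict U) ∧
    ∀ φ : EuclideanSpace ℝ (Fin n) → ℝ, ContDiff ℝ ∞ φ → HasCompactSupport φ → tsupport φ ⊆ U →
      ∀ v : EuclideanSpace ℝ (Fin n),
        ∫ x in U, u x * fderiv ℝ φ x v = - ∫ x in U, ⟪G x, v⟫_ℝ * φ x

/-- The norm of `W^{1,p}(U)`, `1 ≤ p ≤ ∞`, for a function `u` with weak gradient `G`. -/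
def wNorm {n : ℕ} (p : ℝ≥0∞) (U : Set (EuclideanSpace ℝ (Fin n)))
    (u : EuclideanSpace ℝ (Fin n) → ℝ)
    (G : EuclideanSpace ℝ (Fin n) → EuclideanSpace ℝ (Fin n)) : ℝ≥0∞ :=
  if p = ⊤ then
    max (eLpNorm u ⊤ (volume.restrict U)) (eLpNorm G ⊤ (volume.restrict U))
  else
    (eLpNorm u p (volume.restrict U) ^ p.toReal +
      eLpNorm G p (volume.restrict U) ^ p.toReal) ^ (1 / p.toReal)

end NonlocalGradient

end

/-! ### Minkowski's inequality for superpositions of translates. -/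

namespace NonlocalGradient

/-! For smooth `u`, the identity `u(x) - u(x - z) = ∫₀¹ Du(x - tz)·z dt` turns the nonlocal gradient
into an average of translates `x ↦ Du(x - tz)`, each projected on the direction `z/|z|`, against the
measure `(n-1+s) ρ_δ(z) dz dt` (`IsCutoff.smoothGrad_eq_segmentAverage`). This measure has total
mass `(n-1+s) ‖ρ_δ‖₁`, so Minkowski's inequality gives the estimate with the stated constant for all
`1 ≤ p ≤ ∞` (`eLpNorm_segmentAverage_le`).

For `u ∈ W^{1,p}(Ω_δ)` with `p < ∞`, extend `u` and `G = Du` by zero and mollify. The support of `w`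
is compact in the open ball, so the segments issuing from `Ω` keep a uniform distance from the
complement of `Ω_δ`; there mollification commutes with the gradient. On `Ω` the nonlocal gradients
of the mollifications are thus the segment averages of the mollified `G`, which converge in `L^p` to
that of `G` (`MemW.isSmoothLimit`).

The bounds concern every `V` admitted by the definition through `L¹` limits, so uniqueness is
needed: nonlocal integration by parts passes to the limit and determines `V` a.e. in `Ω`
(`IsNonlocalGrad.ae_eq`). For `p = ∞` the mollifications are used only in `L¹`, to identify `V` as a
segment average; the `L^∞` bound then comes from Minkowski. -/

lemma lintegral_rpow_le_measure_univ_mul {Θ : Type*} [MeasurableSpace Θ] {ν : Measure Θ} {f : Θ → ℝ≥0∞} (hf : AEMeasurable f ν) {r : ℝ}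
    (hr : 1 ≤ r) :
    (∫⁻ θ, f θ ∂ν) ^ r ≤ ν Set.univ ^ (r - 1) * ∫⁻ θ, f θ ^ r ∂ν := by
  have hr0 : 0 < r := by linarith
  have key := eLpNorm'_le_eLpNorm'_mul_rpow_measure_univ (μ := ν) zero_lt_one hr
    hf.aestronglyMeasurable
  simp only [eLpNorm', enorm_eq_self, ENNReal.rpow_one, div_one] at key
  calc (∫⁻ θ, f θ ∂ν) ^ r
      ≤ ((∫⁻ θ, f θ ^ r ∂ν) ^ (1 / r) * ν Set.univ ^ (1 - 1 / r)) ^ r :=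
        ENNReal.rpow_le_rpow key hr0.le
    _ = _ := by
        rw [ENNReal.mul_rpow_of_nonneg _ _ hr0.le, ← ENNReal.rpow_mul, ← ENNReal.rpow_mul,
          one_div_mul_cancel hr0.ne', ENNReal.rpow_one, mul_comm]
        congr 2
        field_simp

section Translations

variable {Θ E F F' : Type*} [MeasurableSpace Θ] [NormedAddCommGroup E] [NormedSpace ℝ E]
  [FiniteDimensional ℝ E] [MeasurableSpace E] [BorelSpace E] [NormedAddCommGroup F]
  [NormedAddCommGroup F'] {μ : Measure E} [μ.IsAddHaarMeasure] {ν : Measure Θ} [IsFiniteMeasure ν]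
  {h : Θ → E} {g : E → F} {p : ℝ≥0∞}

/-- Each slice in `x` is a translation. This makes the composition of a merely a.e.-defined `g` with
`x - h θ` meaningful on the product. -/
lemma quasiMeasurePreserving_sub_comp (hh : Measurable h) :
    Measure.QuasiMeasurePreserving (fun q : E × Θ => q.1 - h q.2) (μ.prod ν) μ :=
  QuasiMeasurePreserving.prod_of_left (by fun_prop)
    (Eventually.of_forall fun θ => (measurePreserving_sub_right μ (h θ)).quasiMeasurePreserving)

/-- Minkowski's inequality for a superposition of translates. -/
lemma eLpNorm_le_of_enorm_le_lintegral_translate (hh : Measurable h)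
    (hg : AEStronglyMeasurable g μ) {H : E → F'}
    (hH : ∀ x, ‖H x‖ₑ ≤ ∫⁻ θ, ‖g (x - h θ)‖ₑ ∂ν) (hp : 1 ≤ p) :
    eLpNorm H p μ ≤ ν Set.univ * eLpNorm g p μ := by
  have hqmp := quasiMeasurePreserving_sub_comp (μ := μ) (ν := ν) hh
  have hp0 : p ≠ 0 := (zero_lt_one.trans_le hp).ne'
  rcases eq_or_ne p ⊤ with rfl | hpt
  · rw [eLpNorm_exponent_top, eLpNorm_exponent_top]
    refine essSup_le_of_ae_le _ ?_
    have h1 : ∀ᵐ q ∂(μ.prod ν), ‖g (q.1 - h q.2)‖ₑ ≤ eLpNormEssSup g μ :=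
      hqmp.ae (ae_le_eLpNormEssSup (f := g) (μ := μ))
    filter_upwards [Measure.ae_ae_of_ae_prod h1] with x hx
    calc ‖H x‖ₑ ≤ ∫⁻ θ, ‖g (x - h θ)‖ₑ ∂ν := hH x
      _ ≤ ∫⁻ θ, eLpNormEssSup g μ ∂ν := lintegral_mono_ae hx
      _ = _ := by rw [lintegral_const, mul_comm]
  · set r := p.toReal
    have hr : 1 ≤ r := by
      simpa using ENNReal.toReal_mono hpt hp
    have hr0 : 0 < r := by linarith
    have hm : AEMeasurable (fun q : E × Θ => ‖g (q.1 - h q.2)‖ₑ) (μ.prod ν) :=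
      (hg.comp_quasiMeasurePreserving hqmp).enorm
    rw [eLpNorm_eq_lintegral_rpow_enorm_toReal hp0 hpt,
      eLpNorm_eq_lintegral_rpow_enorm_toReal hp0 hpt]
    have hsec : ∀ᵐ x ∂μ, AEMeasurable (fun θ => ‖g (x - h θ)‖ₑ) ν :=
      hm.aestronglyMeasurable.prodMk_left.mono fun x hx => hx.aemeasurable
    -- Jensen in `θ`, then Tonelli, then translation invariance; the powers `r - 1` and `1` of the
    -- mass combine to `r`.
    have key : ∫⁻ x, ‖H x‖ₑ ^ r ∂μ ≤ ν Set.univ ^ r * ∫⁻ x, ‖g x‖ₑ ^ r ∂μ := by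
      calc ∫⁻ x, ‖H x‖ₑ ^ r ∂μ
          ≤ ∫⁻ x, ν Set.univ ^ (r - 1) * ∫⁻ θ, ‖g (x - h θ)‖ₑ ^ r ∂ν ∂μ := by
            refine lintegral_mono_ae (hsec.mono fun x hx => ?_)
            exact (ENNReal.rpow_le_rpow (hH x) hr0.le).trans
              (lintegral_rpow_le_measure_univ_mul hx hr)
        _ = ν Set.univ ^ (r - 1) * ∫⁻ x, ∫⁻ θ, ‖g (x - h θ)‖ₑ ^ r ∂ν ∂μ :=
            lintegral_const_mul' _ _
              (ENNReal.rpow_ne_top_of_nonneg (by linarith) (measure_ne_top _ _))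
        _ = ν Set.univ ^ (r - 1) * ∫⁻ θ, ∫⁻ x, ‖g (x - h θ)‖ₑ ^ r ∂μ ∂ν := by
            rw [lintegral_lintegral_swap (hm.pow_const r)]
        _ = ν Set.univ ^ (r - 1) * (ν Set.univ * ∫⁻ x, ‖g x‖ₑ ^ r ∂μ) := by
            congr 1
            have : ∀ θ, ∫⁻ x, ‖g (x - h θ)‖ₑ ^ r ∂μ = ∫⁻ x, ‖g x‖ₑ ^ r ∂μ := fun θ =>
              lintegral_sub_right_eq_self (fun x => ‖g x‖ₑ ^ r) (h θ)
            simp_rw [this]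
            rw [lintegral_const, mul_comm]
        _ = _ := by
            rw [← mul_assoc]
            congr 1
            rcases eq_or_ne (ν Set.univ) 0 with h0 | h0
            · simp [h0, hr0]
            · nth_rewrite 2 [← ENNReal.rpow_one (ν Set.univ)]
              rw [← ENNReal.rpow_add _ _ h0 (measure_ne_top _ _), sub_add_cancel]
    calc (∫⁻ x, ‖H x‖ₑ ^ r ∂μ) ^ (1 / r)
        ≤ (ν Set.univ ^ r * ∫⁻ x, ‖g x‖ₑ ^ r ∂μ) ^ (1 / r) :=
          ENNReal.rpow_le_rpow key (by positivity)
      _ = _ := by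
          rw [ENNReal.mul_rpow_of_nonneg _ _ (by positivity), ← ENNReal.rpow_mul,
            mul_one_div_cancel hr0.ne', ENNReal.rpow_one]

/-- For integrable `g`, almost every superposition of translates is absolutely convergent. -/
lemma ae_integrable_translate (hh : Measurable h) (hg : Integrable g μ) :
    ∀ᵐ x ∂μ, Integrable (fun θ => g (x - h θ)) ν := by
  have hm : AEStronglyMeasurable (fun q : E × Θ => g (q.1 - h q.2)) (μ.prod ν) :=
    hg.1.comp_quasiMeasurePreserving (quasiMeasurePreserving_sub_comp hh)
  refine Integrable.prod_right_ae (f := fun q : E × Θ => g (q.1 - h q.2)) ?_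
  rw [integrable_prod_iff' hm]
  refine ⟨Eventually.of_forall fun θ => hg.comp_sub_right (h θ), ?_⟩
  have : ∀ θ, ∫ x, ‖g (x - h θ)‖ ∂μ = ∫ x, ‖g x‖ ∂μ := fun θ =>
    integral_sub_right_eq_self (fun x => ‖g x‖) (h θ)
  simp_rw [this]
  exact integrable_const _

end Translations

/-! ### Mollification in `L^p`. -/

section Mollification

variable {E F : Type*} [NormedAddCommGroup E] [NormedSpace ℝ E]
  [FiniteDimensional ℝ E] [MeasurableSpace E] [BorelSpace E] [HasContDiffBump E]
  [NormedAddCommGroup F] [NormedSpace ℝ F]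
  {μ : Measure E} [μ.IsAddHaarMeasure] {g : E → F} {p : ℝ≥0∞}

open ContinuousLinearMap (lsmul)
open scoped Convolution

/-- Convolution with a normalised bump is a superposition of translates against a probability
measure, so Minkowski applies with mass one. -/
lemma eLpNorm_normed_convolution_le (φ : ContDiffBump (0 : E)) (hg : AEStronglyMeasurable g μ)
    (hp : 1 ≤ p) : eLpNorm (φ.normed μ ⋆[lsmul ℝ ℝ, μ] g) p μ ≤ eLpNorm g p μ := by
  set ν : Measure E := μ.withDensity fun z => ENNReal.ofReal (φ.normed μ z)
  have hmeas : Measurable fun z => ENNReal.ofReal (φ.normed μ z) :=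
    φ.continuous_normed.measurable.ennreal_ofReal
  have hν : ν Set.univ = 1 := by
    rw [withDensity_apply _ MeasurableSet.univ, Measure.restrict_univ,
      ← ofReal_integral_eq_lintegral_ofReal φ.integrable_normed
        (Eventually.of_forall φ.nonneg_normed), φ.integral_normed, ENNReal.ofReal_one]
  have : IsFiniteMeasure ν := ⟨by simp [hν]⟩
  have := eLpNorm_le_of_enorm_le_lintegral_translate (ν := ν) (μ := μ) (h := id) (p := p)
    measurable_id hg (H := φ.normed μ ⋆[lsmul ℝ ℝ, μ] g) (fun x => ?_) hp
  · simpa [hν] using this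
  · rw [convolution_def]
    refine (enorm_integral_le_lintegral_enorm _).trans ?_
    rw [lintegral_withDensity_eq_lintegral_mul_non_measurable _ hmeas (by simp)]
    refine lintegral_mono fun t => ?_
    simp [enorm_smul, Real.enorm_of_nonneg (φ.nonneg_normed t)]

/-- Mollifications converge in `L^p`, `1 ≤ p < ∞`. -/
lemma tendsto_eLpNorm_normed_convolution_sub [CompleteSpace F]
    {φ : ℕ → ContDiffBump (0 : E)}
    (hφ : Tendsto (fun i => (φ i).rOut) atTop (𝓝 0)) (hg : MemLp g p μ)
    (hgl : LocallyIntegrable g μ)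
    (hp : 1 ≤ p) (hpt : p ≠ ⊤) :
    Tendsto (fun i => eLpNorm (((φ i).normed μ ⋆[lsmul ℝ ℝ, μ] g) - g) p μ) atTop (𝓝 0) := by
  have hp0 : p ≠ 0 := (zero_lt_one.trans_le hp).ne'
  rw [ENNReal.tendsto_nhds_zero]
  intro ε hε
  have hε3 : ε / 3 ≠ 0 := by simp [hε.ne']
  obtain ⟨c, hcs, hcε, hcc, hcm⟩ := hg.exists_hasCompactSupport_eLpNorm_sub_le hpt hε3
  have hcl : LocallyIntegrable c μ := hcc.locallyIntegrable
  set S : Set E := Metric.cthickening 1 (tsupport c)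
  have hSc : IsCompact S := hcs.isCompact.cthickening
  have hSm : μ S ≠ ⊤ := hSc.measure_lt_top.ne
  have hunif := hcs.uniformContinuous_of_continuous hcc
  -- `κ` is the uniform error allowed between `c` and its mollification, which both live on `S`.
  obtain ⟨κ, hκ0, hκ⟩ : ∃ κ : ℝ≥0, 0 < κ ∧ μ S ^ (1 / p.toReal) * κ ≤ ε / 3 := by
    have hA : μ S ^ (1 / p.toReal) ≠ ⊤ :=
      ENNReal.rpow_ne_top_of_nonneg (by positivity) hSm
    obtain ⟨κ, hκ0, hκ⟩ := ENNReal.exists_nnreal_pos_mul_lt hA hε3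
    exact ⟨κ, hκ0, by rw [mul_comm]; exact hκ.le⟩
  obtain ⟨η, hη0, hη⟩ := Metric.uniformContinuous_iff.1 hunif κ hκ0
  -- Radius below `η` makes the oscillation of `c` at most `κ`; radius below `1` keeps the support
  -- in `S`.
  have hev : ∀ᶠ i in atTop, (φ i).rOut < min η 1 := hφ.eventually_lt_const (by positivity)
  filter_upwards [hev] with i hi
  have hiη : (φ i).rOut < η := hi.trans_le (min_le_left _ _)
  have hi1 : (φ i).rOut < 1 := hi.trans_le (min_le_right _ _)
  have hce : ∀ f : E → F, LocallyIntegrable f μ →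
      ConvolutionExists ((φ i).normed μ) f (lsmul ℝ ℝ) μ := fun f hf =>
    (φ i).hasCompactSupport_normed.convolutionExists_left _ (φ i).continuous_normed hf
  have hsum : ((φ i).normed μ ⋆[lsmul ℝ ℝ, μ] g) =
      ((φ i).normed μ ⋆[lsmul ℝ ℝ, μ] (g - c)) + ((φ i).normed μ ⋆[lsmul ℝ ℝ, μ] c) := by
    rw [← (hce _ (hgl.sub hcl)).distrib_add (hce _ hcl), sub_add_cancel]
  have hcm2 : AEStronglyMeasurable ((φ i).normed μ ⋆[lsmul ℝ ℝ, μ] c) μ :=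
    ((φ i).hasCompactSupport_normed.continuous_convolution_left _
      (φ i).continuous_normed hcl).aestronglyMeasurable
  have hgm2 : AEStronglyMeasurable ((φ i).normed μ ⋆[lsmul ℝ ℝ, μ] (g - c)) μ :=
    ((φ i).hasCompactSupport_normed.continuous_convolution_left _
      (φ i).continuous_normed (hgl.sub hcl)).aestronglyMeasurable
  have hmid : eLpNorm (((φ i).normed μ ⋆[lsmul ℝ ℝ, μ] c) - c) p μ ≤ ε / 3 := by
    have hsupp : Function.support (((φ i).normed μ ⋆[lsmul ℝ ℝ, μ] c) - c) ⊆ S := by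
      intro x hx
      by_contra hxS
      apply hx
      have hzero : ∀ y ∈ Metric.ball x (φ i).rOut, c y = 0 := by
        intro y hy
        by_contra hcy
        apply hxS
        have hyt : y ∈ tsupport c := subset_tsupport _ hcy
        refine Metric.mem_cthickening_of_dist_le x y 1 _ hyt ?_
        rw [dist_comm]
        exact ((Metric.mem_ball.1 hy).trans hi1).le
      have hx0 : c x = 0 := hzero x (Metric.mem_ball_self (φ i).rOut_pos)
      have := (φ i).normed_convolution_eq_right (μ := μ) (g := c) (x₀ := x)
        (fun y hy => by rw [hzero y hy, hx0])
      simp [this]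
    rw [← eLpNorm_restrict_eq_of_support_subset hsupp]
    refine (eLpNorm_le_of_ae_bound (C := κ) (Eventually.of_forall fun x => ?_)).trans ?_
    · rw [Pi.sub_apply, ← dist_eq_norm]
      refine (φ i).dist_normed_convolution_le hcc.aestronglyMeasurable fun y hy => ?_
      exact (hη ((Metric.mem_ball.1 hy).trans hiη)).le
    · rw [Measure.restrict_apply_univ, ENNReal.ofReal_coe_nnreal, ← one_div]
      exact hκ
  calc eLpNorm (((φ i).normed μ ⋆[lsmul ℝ ℝ, μ] g) - g) p μ
      = eLpNorm ((((φ i).normed μ ⋆[lsmul ℝ ℝ, μ] (g - c))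
          + (((φ i).normed μ ⋆[lsmul ℝ ℝ, μ] c) - c)) - (g - c)) p μ := by
        rw [hsum]; congr 1; abel
    _ ≤ eLpNorm (((φ i).normed μ ⋆[lsmul ℝ ℝ, μ] (g - c))
          + (((φ i).normed μ ⋆[lsmul ℝ ℝ, μ] c) - c)) p μ + eLpNorm (g - c) p μ :=
        eLpNorm_sub_le (hgm2.add (hcm2.sub hcm.1)) (hg.1.sub hcm.1) hp
    _ ≤ (eLpNorm ((φ i).normed μ ⋆[lsmul ℝ ℝ, μ] (g - c)) p μ
          + eLpNorm (((φ i).normed μ ⋆[lsmul ℝ ℝ, μ] c) - c) p μ) + eLpNorm (g - c) p μ := by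
        gcongr
        exact eLpNorm_add_le hgm2 (hcm2.sub hcm.1) hp
    _ ≤ (ε / 3 + ε / 3) + ε / 3 := by
        gcongr
        exact (eLpNorm_normed_convolution_le (φ i) (hg.1.sub hcm.1) hp).trans hcε
    _ = ε := ENNReal.add_thirds ε

end Mollification

end NonlocalGradient

/-! ### The kernel and averages along segments. -/

noncomputable section

namespace NonlocalGradient

variable {n : ℕ} {s δ : ℝ} {w : EuclideanSpace ℝ (Fin n) → ℝ}

lemma gammaConst_one_sub_pos (hn : 1 ≤ n) (hs0 : 0 < s) (hs1 : s < 1) :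
    0 < gammaConst n (1 - s) := by
  have hn' : (1 : ℝ) ≤ n := by exact_mod_cast hn
  have h1 : 0 < Real.Gamma ((1 - s) / 2) := Real.Gamma_pos_of_pos (by linarith)
  have h2 : 0 < Real.Gamma (((n : ℝ) - (1 - s)) / 2) := Real.Gamma_pos_of_pos (by linarith)
  have := Real.pi_pos
  unfold gammaConst
  positivity

lemma IsCutoff.rho_nonneg (hw : IsCutoff δ w) (hn : 1 ≤ n) (hs0 : 0 < s) (hs1 : s < 1)
    (z : EuclideanSpace ℝ (Fin n)) : 0 ≤ rho s w z := by
  have := gammaConst_one_sub_pos hn hs0 hs1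
  have := hw.nonneg z
  unfold rho
  positivity

lemma IsCutoff.measurable_rho (hw : IsCutoff δ w) : Measurable (rho s w) := by
  have := hw.smooth.continuous.measurable
  unfold rho
  fun_prop

lemma IsCutoff.eq_zero_of_notMem_ball (hw : IsCutoff δ w) {z : EuclideanSpace ℝ (Fin n)}
    (hz : z ∉ Metric.ball (0 : EuclideanSpace ℝ (Fin n)) δ) : w z = 0 :=
  image_eq_zero_of_notMem_tsupport fun h => hz (hw.tsupport_subset h)

/-- The singularity has order `n - 1 + s < n`, and `w` is bounded and vanishes off the ball. -/
lemma IsCutoff.integrable_rho (hw : IsCutoff δ w) (hn : 1 ≤ n) (hs0 : 0 < s) (hs1 : s < 1) :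
    Integrable (rho s w) := by
  obtain ⟨a, b, ha, -, -, hwa, -⟩ := hw.plateau
  have hγ := gammaConst_one_sub_pos hn hs0 hs1
  have hball : IntegrableOn (rho s w) (Metric.ball 0 δ) := by
    refine integrableOn_ball_of_norm_le_rpow (C := a / gammaConst n (1 - s)) (α := (n : ℝ) - 1 + s)
      (by simpa using hn) (by simp; linarith) (Eventually.of_forall fun z => ?_)
      hw.measurable_rho.aestronglyMeasurable
    rw [Real.norm_of_nonneg (hw.rho_nonneg hn hs0 hs1 z), rho, Real.rpow_neg (norm_nonneg z)]
    calc 1 / (gammaConst n (1 - s) * ‖z‖ ^ ((n : ℝ) - 1 + s)) * w z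
        ≤ 1 / (gammaConst n (1 - s) * ‖z‖ ^ ((n : ℝ) - 1 + s)) * a := by
          gcongr
          exact hwa z
      _ = _ := by ring
  refine (integrableOn_iff_integrable_of_support_subset fun z hz => ?_).1 hball
  by_contra h
  exact hz (by simp [rho, hw.eq_zero_of_notMem_ball h])

/-- The measure `(n - 1 + s) ρ_δ(z) dz ⊗ dt` on `ℝⁿ × [0, 1]`. -/
def segmentMeasure (s : ℝ) (w : EuclideanSpace ℝ (Fin n) → ℝ) :
    Measure (EuclideanSpace ℝ (Fin n) × ℝ) :=
  (volume.withDensity fun z => ENNReal.ofReal (((n : ℝ) - 1 + s) * rho s w z)).prod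
    (volume.restrict (Set.Icc 0 1))

/-- The average of the directional components of the vector field `g` along the segments `[x - z, x]`,
weighted by `(n - 1 + s) ρ_δ(z)`. -/
def segmentAverage (s : ℝ) (w : EuclideanSpace ℝ (Fin n) → ℝ)
    (g : EuclideanSpace ℝ (Fin n) → EuclideanSpace ℝ (Fin n)) (x : EuclideanSpace ℝ (Fin n)) :
    EuclideanSpace ℝ (Fin n) :=
  ∫ θ, ⟪g (x - θ.2 • θ.1), ‖θ.1‖⁻¹ • θ.1⟫_ℝ • (‖θ.1‖⁻¹ • θ.1) ∂segmentMeasure s w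

/-- Source of the constant in the theorem: the `t`-interval has length one, so only the mass of the
kernel remains. -/
lemma IsCutoff.segmentMeasure_univ (hw : IsCutoff δ w) (hn : 1 ≤ n) (hs0 : 0 < s) (hs1 : s < 1) :
    segmentMeasure s w Set.univ = ENNReal.ofReal ((n : ℝ) - 1 + s) * eLpNorm (rho s w) 1 volume := by
  have hn' : (1 : ℝ) ≤ n := by exact_mod_cast hn
  rw [segmentMeasure, ← Set.univ_prod_univ, Measure.prod_prod, withDensity_apply _ MeasurableSet.univ,
    Measure.restrict_univ, Measure.restrict_apply_univ, Real.volume_Icc, sub_zero, ENNReal.ofReal_one,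
    mul_one, eLpNorm_one_eq_lintegral_enorm, ← lintegral_const_mul' _ _ ENNReal.ofReal_ne_top]
  refine lintegral_congr fun z => ?_
  rw [ENNReal.ofReal_mul (by linarith), Real.enorm_of_nonneg (hw.rho_nonneg hn hs0 hs1 z)]

lemma IsCutoff.isFiniteMeasure_segmentMeasure (hw : IsCutoff δ w) (hn : 1 ≤ n) (hs0 : 0 < s)
    (hs1 : s < 1) : IsFiniteMeasure (segmentMeasure s w) := by
  refine ⟨?_⟩
  rw [hw.segmentMeasure_univ hn hs0 hs1]
  exact ENNReal.mul_lt_top ENNReal.ofReal_lt_top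
    (memLp_one_iff_integrable.2 (hw.integrable_rho hn hs0 hs1)).2

/-- Equality fails only at `z = 0`, where the direction is `0` because `0⁻¹ = 0`. -/
lemma norm_inv_norm_smul_le (z : EuclideanSpace ℝ (Fin n)) : ‖‖z‖⁻¹ • z‖ ≤ 1 := by
  rw [norm_smul, norm_inv, norm_norm]
  exact inv_mul_le_one

lemma norm_inner_smul_direction_le (a z : EuclideanSpace ℝ (Fin n)) :
    ‖⟪a, ‖z‖⁻¹ • z⟫_ℝ • (‖z‖⁻¹ • z)‖ ≤ ‖a‖ := by
  have h := norm_inv_norm_smul_le z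
  calc ‖⟪a, ‖z‖⁻¹ • z⟫_ℝ • (‖z‖⁻¹ • z)‖ = ‖⟪a, ‖z‖⁻¹ • z⟫_ℝ‖ * ‖‖z‖⁻¹ • z‖ := norm_smul _ _
    _ ≤ (‖a‖ * ‖‖z‖⁻¹ • z‖) * ‖‖z‖⁻¹ • z‖ := by gcongr; exact norm_inner_le_norm _ _
    _ ≤ (‖a‖ * 1) * 1 := by gcongr
    _ = ‖a‖ := by ring

variable {g g₁ g₂ : EuclideanSpace ℝ (Fin n) → EuclideanSpace ℝ (Fin n)} {p : ℝ≥0∞}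

/-- Projecting on a direction does not increase the norm, so Minkowski applies to the shifts `t •
z`. -/
lemma eLpNorm_segmentAverage_le [IsFiniteMeasure (segmentMeasure s w)]
    (hg : AEStronglyMeasurable g) (hp : 1 ≤ p) :
    eLpNorm (segmentAverage s w g) p volume ≤
      segmentMeasure s w Set.univ * eLpNorm g p volume := by
  refine eLpNorm_le_of_enorm_le_lintegral_translate
    (h := fun θ : EuclideanSpace ℝ (Fin n) × ℝ => θ.2 • θ.1) (by fun_prop) hg (fun x => ?_) hp
  refine (enorm_integral_le_lintegral_enorm _).trans (lintegral_mono fun θ => ?_)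
  rw [enorm_le_iff_norm_le]
  exact norm_inner_smul_direction_le _ _

lemma aestronglyMeasurable_segmentIntegrand [IsFiniteMeasure (segmentMeasure s w)]
    (hg : AEStronglyMeasurable g) :
    AEStronglyMeasurable (fun q : EuclideanSpace ℝ (Fin n) × (EuclideanSpace ℝ (Fin n) × ℝ) =>
      ⟪g (q.1 - q.2.2 • q.2.1), ‖q.2.1‖⁻¹ • q.2.1⟫_ℝ • (‖q.2.1‖⁻¹ • q.2.1))
      (volume.prod (segmentMeasure s w)) := by
  have h1 : AEStronglyMeasurable
      (fun q : EuclideanSpace ℝ (Fin n) × (EuclideanSpace ℝ (Fin n) × ℝ) =>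
        g (q.1 - q.2.2 • q.2.1)) (volume.prod (segmentMeasure s w)) :=
    hg.comp_quasiMeasurePreserving (quasiMeasurePreserving_sub_comp
      (h := fun θ : EuclideanSpace ℝ (Fin n) × ℝ => θ.2 • θ.1) (by fun_prop))
  have h2 : AEStronglyMeasurable
      (fun q : EuclideanSpace ℝ (Fin n) × (EuclideanSpace ℝ (Fin n) × ℝ) => ‖q.2.1‖⁻¹ • q.2.1)
      (volume.prod (segmentMeasure s w)) :=
    Measurable.aestronglyMeasurable (by fun_prop)
  exact (h1.inner (𝕜 := ℝ) h2).smul h2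

lemma aestronglyMeasurable_segmentAverage [IsFiniteMeasure (segmentMeasure s w)]
    (hg : AEStronglyMeasurable g) : AEStronglyMeasurable (segmentAverage s w g) :=
  (aestronglyMeasurable_segmentIntegrand hg).integral_prod_right'

/-- Linearity is asserted only a.e.: the Bochner integral needs integrable integrands, which
integrability of the fields yields for almost every `x`. -/
lemma segmentAverage_sub_ae [IsFiniteMeasure (segmentMeasure s w)]
    (h₁ : Integrable g₁) (h₂ : Integrable g₂) :
    segmentAverage s w (g₁ - g₂) =ᵐ[volume] segmentAverage s w g₁ - segmentAverage s w g₂ := by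
  have hint : ∀ {g : EuclideanSpace ℝ (Fin n) → EuclideanSpace ℝ (Fin n)}, Integrable g →
      ∀ᵐ x, Integrable (fun θ : EuclideanSpace ℝ (Fin n) × ℝ =>
        ⟪g (x - θ.2 • θ.1), ‖θ.1‖⁻¹ • θ.1⟫_ℝ • (‖θ.1‖⁻¹ • θ.1)) (segmentMeasure s w) := by
    intro g hg
    filter_upwards [ae_integrable_translate (ν := segmentMeasure s w)
      (h := fun θ : EuclideanSpace ℝ (Fin n) × ℝ => θ.2 • θ.1) (by fun_prop) hg,
      (aestronglyMeasurable_segmentIntegrand (s := s) (w := w) hg.1).prodMk_left] with x hx hxm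
    exact hx.mono hxm (Eventually.of_forall fun θ => norm_inner_smul_direction_le _ _)
  filter_upwards [hint h₁, hint h₂] with x hx₁ hx₂
  simp only [segmentAverage, Pi.sub_apply]
  rw [← integral_sub hx₁ hx₂]
  simp only [inner_sub_left, sub_smul]

/-- The vector kernel `c_{n,s} w_δ(z) z / |z|^{n+1+s}` of the nonlocal gradient. -/
def gradKernel (s : ℝ) (w : EuclideanSpace ℝ (Fin n) → ℝ) (z : EuclideanSpace ℝ (Fin n)) :
    EuclideanSpace ℝ (Fin n) :=
  ((((n : ℝ) - 1 + s) * rho s w z) * ‖z‖⁻¹) • (‖z‖⁻¹ • z)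

lemma IsCutoff.measurable_gradKernel (hw : IsCutoff δ w) : Measurable (gradKernel s w) := by
  have := hw.measurable_rho (s := s)
  unfold gradKernel
  fun_prop

lemma IsCutoff.gradKernel_eq_zero (hw : IsCutoff δ w) {z : EuclideanSpace ℝ (Fin n)}
    (hz : z ∉ Metric.ball (0 : EuclideanSpace ℝ (Fin n)) δ) : gradKernel s w z = 0 := by
  simp [gradKernel, rho, hw.eq_zero_of_notMem_ball hz]

/-- The kernel alone has the non-integrable order `|z|^{-n-s}`; the factor `‖z‖`, supplied by a
Lipschitz difference, restores integrability. -/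
lemma IsCutoff.norm_mul_norm_gradKernel_le (hw : IsCutoff δ w) (hn : 1 ≤ n) (hs0 : 0 < s)
    (hs1 : s < 1) (z : EuclideanSpace ℝ (Fin n)) :
    ‖z‖ * ‖gradKernel s w z‖ ≤ ((n : ℝ) - 1 + s) * rho s w z := by
  have hn' : (1 : ℝ) ≤ n := by exact_mod_cast hn
  have hnn : 0 ≤ ((n : ℝ) - 1 + s) * rho s w z :=
    mul_nonneg (by linarith) (hw.rho_nonneg hn hs0 hs1 z)
  rw [gradKernel, norm_smul, norm_mul, Real.norm_of_nonneg hnn, norm_inv, norm_norm]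
  calc ‖z‖ * (((n : ℝ) - 1 + s) * rho s w z * ‖z‖⁻¹ * ‖‖z‖⁻¹ • z‖)
      = (((n : ℝ) - 1 + s) * rho s w z) * ((‖z‖ * ‖z‖⁻¹) * ‖‖z‖⁻¹ • z‖) := by ring
    _ ≤ (((n : ℝ) - 1 + s) * rho s w z) * (1 * 1) := by
        gcongr
        · exact mul_inv_le_one
        · exact norm_inv_norm_smul_le z
    _ = _ := by ring

/-- Substitute `z = x - y`; the ball may be dropped because `w` vanishes outside it. -/
lemma IsCutoff.smoothGrad_eq_integral_gradKernel (hw : IsCutoff δ w)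
    (u : EuclideanSpace ℝ (Fin n) → ℝ) (x : EuclideanSpace ℝ (Fin n)) :
    smoothGrad s δ w u x = ∫ z, (u x - u (x - z)) • gradKernel s w z := by
  rw [smoothGrad, setIntegral_eq_integral_of_forall_compl_eq_zero, ← integral_smul,
    ← integral_sub_left_eq_self _ _ x]
  · refine integral_congr_ae (Eventually.of_forall fun z => ?_)
    simp only [sub_sub_cancel, gradKernel, rho, cConst, smul_smul]
    congr 1
    ring
  · intro y hy
    have : w (x - y) = 0 := hw.eq_zero_of_notMem_ball (by
      rw [Metric.mem_ball, dist_eq_norm, norm_sub_rev] at hy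
      simpa using hy)
    simp [this]

/-- On smooth functions the nonlocal gradient is the average of the gradient along segments. -/
lemma IsCutoff.smoothGrad_eq_segmentAverage (hw : IsCutoff δ w) (hn : 1 ≤ n) (hs0 : 0 < s)
    (hs1 : s < 1) {u : EuclideanSpace ℝ (Fin n) → ℝ} (hu : ContDiff ℝ 1 u)
    (hus : HasCompactSupport u) {x : EuclideanSpace ℝ (Fin n)}
    (hg : ∀ z, w z ≠ 0 → ∀ t ∈ Set.Icc (0 : ℝ) 1, ∀ v,
      fderiv ℝ u (x - t • z) v = ⟪g (x - t • z), v⟫_ℝ) :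
    smoothGrad s δ w u x = segmentAverage s w g x := by
  have hn' : (1 : ℝ) ≤ n := by exact_mod_cast hn
  have := hw.isFiniteMeasure_segmentMeasure hn hs0 hs1
  set b : EuclideanSpace ℝ (Fin n) → ℝ := fun z => ((n : ℝ) - 1 + s) * rho s w z
  have hb0 : ∀ z, 0 ≤ b z := fun z => mul_nonneg (by linarith) (hw.rho_nonneg hn hs0 hs1 z)
  have hbm : Measurable b := hw.measurable_rho.const_mul _
  have hbi : Integrable b := (hw.integrable_rho hn hs0 hs1).const_mul _
  set m : Measure (EuclideanSpace ℝ (Fin n)) := volume.withDensity fun z => ENNReal.ofReal (b z)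
  have hmfin : IsFiniteMeasure m := isFiniteMeasure_withDensity_ofReal hbi.2
  obtain ⟨C, hC⟩ := (hus.fderiv ℝ).exists_bound_of_continuous (hu.continuous_fderiv one_ne_zero)
  -- replace `g` by the derivative of `u`
  set A : EuclideanSpace ℝ (Fin n) × ℝ → EuclideanSpace ℝ (Fin n) := fun θ =>
    (fderiv ℝ u (x - θ.2 • θ.1) (‖θ.1‖⁻¹ • θ.1)) • (‖θ.1‖⁻¹ • θ.1)
  -- The density vanishes wherever `w` does, so it is enough that `g` equals the gradient on
  -- segments with `w z ≠ 0`.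
  have hwm : ∀ᵐ z ∂m, w z ≠ 0 := by
    rw [ae_withDensity_iff hbm.ennreal_ofReal]
    refine Eventually.of_forall fun z hz hwz => hz ?_
    simp [b, rho, hwz]
  have hae : ∀ᵐ θ ∂(segmentMeasure s w), w θ.1 ≠ 0 ∧ θ.2 ∈ Set.Icc (0 : ℝ) 1 := by
    refine Eventually.and ?_ ?_
    · exact Measure.quasiMeasurePreserving_fst.ae hwm
    · exact Measure.quasiMeasurePreserving_snd.ae (ae_restrict_mem measurableSet_Icc)
  have hKA : segmentAverage s w g x = ∫ θ, A θ ∂(m.prod (volume.restrict (Set.Icc 0 1))) := by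
    refine integral_congr_ae ?_
    filter_upwards [hae] with θ hθ
    simp only [A]
    rw [hg θ.1 hθ.1 θ.2 hθ.2]
  have hAm : Measurable A := by
    have h1 : Measurable fun θ : EuclideanSpace ℝ (Fin n) × ℝ => fderiv ℝ u (x - θ.2 • θ.1) :=
      (hu.continuous_fderiv one_ne_zero).measurable.comp (by fun_prop)
    have h2 : Measurable fun θ : EuclideanSpace ℝ (Fin n) × ℝ => ‖θ.1‖⁻¹ • θ.1 := by fun_prop
    have h3 : Measurable fun θ : EuclideanSpace ℝ (Fin n) × ℝ =>
        fderiv ℝ u (x - θ.2 • θ.1) (‖θ.1‖⁻¹ • θ.1) :=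
      (isBoundedBilinearMap_apply.continuous.measurable.comp (h1.prodMk h2) :)
    exact h3.smul h2
  have hAi : Integrable A (m.prod (volume.restrict (Set.Icc 0 1))) := by
    refine Integrable.of_bound hAm.aestronglyMeasurable C (Eventually.of_forall fun θ => ?_)
    have h1 := norm_inv_norm_smul_le θ.1
    have h0 := hC (x - θ.2 • θ.1)
    have hC0 : 0 ≤ C := (norm_nonneg _).trans h0
    calc ‖A θ‖ = ‖fderiv ℝ u (x - θ.2 • θ.1) (‖θ.1‖⁻¹ • θ.1)‖ * ‖‖θ.1‖⁻¹ • θ.1‖ := norm_smul _ _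
      _ ≤ (C * 1) * 1 := by
          gcongr
          exact (ContinuousLinearMap.le_opNorm _ _).trans (by gcongr)
      _ = C := by ring
  rw [hKA, integral_prod _ hAi, integral_withDensity_eq_integral_toReal_smul
    hbm.ennreal_ofReal (by simp), hw.smoothGrad_eq_integral_gradKernel]
  refine integral_congr_ae (Eventually.of_forall fun z => ?_)
  simp only [A, ENNReal.toReal_ofReal (hb0 z)]
  rw [integral_smul_const]
  -- Fundamental theorem of calculus along `t ↦ x - t • z`; for `z = 0` both sides vanish.
  have hftc : ∫ t in Set.Icc (0 : ℝ) 1, fderiv ℝ u (x - t • z) (‖z‖⁻¹ • z) =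
      (u x - u (x - z)) * ‖z‖⁻¹ := by
    have hd : ∀ t ∈ Set.uIcc (0 : ℝ) 1,
        HasDerivAt (fun t : ℝ => u (x - t • z)) (fderiv ℝ u (x - t • z) (-z)) t := by
      intro t _
      have h1 : HasDerivAt (fun t : ℝ => x - t • z) (-z) t := by
        simpa using ((hasDerivAt_id t).smul_const z).const_sub x
      exact ((hu.differentiable one_ne_zero).differentiableAt.hasFDerivAt).comp_hasDerivAt t h1
    have hc : Continuous fun t : ℝ => fderiv ℝ u (x - t • z) (-z) :=
      ((hu.continuous_fderiv one_ne_zero).comp (by fun_prop)).clm_apply continuous_const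
    have h2 := intervalIntegral.integral_eq_sub_of_hasDerivAt hd (hc.intervalIntegrable 0 1)
    rw [integral_Icc_eq_integral_Ioc, ← intervalIntegral.integral_of_le zero_le_one]
    have h3 : ∀ t : ℝ, fderiv ℝ u (x - t • z) (‖z‖⁻¹ • z) =
        -‖z‖⁻¹ * fderiv ℝ u (x - t • z) (-z) := by
      intro t; simp
    simp_rw [h3]
    rw [intervalIntegral.integral_const_mul, h2]
    simp
    ring
  rw [hftc]
  simp only [b, gradKernel, smul_smul]
  congr 1
  ring

end NonlocalGradient
end

/-! ### Nonlocal integration by parts and uniqueness of the nonlocal gradient. -/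

noncomputable section

namespace NonlocalGradient

lemma tendsto_integral_of_tendsto_eLpNorm_sub {X F G : Type*} [MeasurableSpace X] {μ : Measure X}
    [NormedAddCommGroup F] [NormedAddCommGroup G] [NormedSpace ℝ G] {T : ℕ → X → G} {T₀ : X → G}
    {f : ℕ → X → F} {f₀ : X → F} {C : ℝ} (hT : ∀ j, AEStronglyMeasurable (T j) μ)
    (hT₀ : Integrable T₀ μ) (hle : ∀ j x, ‖T j x - T₀ x‖ ≤ C * ‖f j x - f₀ x‖)
    (hf : Tendsto (fun j => eLpNorm (f j - f₀) 1 μ) atTop (𝓝 0)) :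
    Tendsto (fun j => ∫ x, T j x ∂μ) atTop (𝓝 (∫ x, T₀ x ∂μ)) := by
  have hle' : ∀ j, ∫⁻ x, ‖T j x - T₀ x‖ₑ ∂μ ≤ ENNReal.ofReal C * eLpNorm (f j - f₀) 1 μ := by
    intro j
    rw [← eLpNorm_one_eq_lintegral_enorm]
    exact eLpNorm_le_mul_eLpNorm_of_ae_le_mul (Eventually.of_forall fun x => hle j x) 1
  have hlim : Tendsto (fun j => ENNReal.ofReal C * eLpNorm (f j - f₀) 1 μ) atTop (𝓝 0) := by
    simpa using ENNReal.Tendsto.const_mul hf (Or.inr ENNReal.ofReal_ne_top)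
  refine tendsto_integral_of_L1 T₀ hT₀.1 ?_
    (tendsto_of_tendsto_of_tendsto_of_le_of_le tendsto_const_nhds hlim (fun _ => zero_le) hle')
  -- The `L¹` distance may be infinite for small `j`; `T j` is integrable once it is finite.
  filter_upwards [hlim.eventually_lt_const ENNReal.zero_lt_top] with j hj
  have : Integrable (T j - T₀) μ :=
    ⟨(hT j).sub hT₀.1, (hle' j).trans_lt hj⟩
  simpa using this.add hT₀

variable {n : ℕ} {s δ : ℝ} {w : EuclideanSpace ℝ (Fin n) → ℝ}

/-- The formal adjoint of the nonlocal gradient. -/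
def adjointGrad (s : ℝ) (w : EuclideanSpace ℝ (Fin n) → ℝ) (Φ : EuclideanSpace ℝ (Fin n) → ℝ)
    (x : EuclideanSpace ℝ (Fin n)) : EuclideanSpace ℝ (Fin n) :=
  ∫ z, (Φ x - Φ (x + z)) • gradKernel s w z

variable {u Φ : EuclideanSpace ℝ (Fin n) → ℝ}

lemma IsCutoff.norm_sub_smul_gradKernel_le (hw : IsCutoff δ w) (hn : 1 ≤ n) (hs0 : 0 < s)
    (hs1 : s < 1) {L : ℝ≥0} (hL : LipschitzWith L Φ) (x y z : EuclideanSpace ℝ (Fin n))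
    (hxy : ‖x - y‖ = ‖z‖) :
    ‖(Φ x - Φ y) • gradKernel s w z‖ ≤ L * (((n : ℝ) - 1 + s) * rho s w z) := by
  rw [norm_smul]
  calc ‖Φ x - Φ y‖ * ‖gradKernel s w z‖ ≤ (L * ‖z‖) * ‖gradKernel s w z‖ := by
        gcongr
        rw [← hxy]
        exact hL.norm_sub_le x y
    _ = L * (‖z‖ * ‖gradKernel s w z‖) := by ring
    _ ≤ _ := mul_le_mul_of_nonneg_left (hw.norm_mul_norm_gradKernel_le hn hs0 hs1 z) L.2

/-- The bound is uniform in `x`, so the adjoint can be paired with a function that is only `L¹`. -/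
lemma IsCutoff.norm_adjointGrad_le (hw : IsCutoff δ w) (hn : 1 ≤ n) (hs0 : 0 < s)
    (hs1 : s < 1) {L : ℝ≥0} (hL : LipschitzWith L Φ) (x : EuclideanSpace ℝ (Fin n)) :
    ‖adjointGrad s w Φ x‖ ≤ ∫ z, L * (((n : ℝ) - 1 + s) * rho s w z) :=
  norm_integral_le_of_norm_le (((hw.integrable_rho hn hs0 hs1).const_mul _).const_mul _)
    (Eventually.of_forall fun z =>
      hw.norm_sub_smul_gradKernel_le hn hs0 hs1 hL x (x + z) z (by simp))

lemma IsCutoff.aestronglyMeasurable_smoothGrad (hw : IsCutoff δ w) (hu : Continuous u) :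
    AEStronglyMeasurable (smoothGrad s δ w u) := by
  have hk := hw.measurable_gradKernel (s := s)
  have h : StronglyMeasurable fun q : EuclideanSpace ℝ (Fin n) × EuclideanSpace ℝ (Fin n) =>
      (u q.1 - u (q.1 - q.2)) • gradKernel s w q.2 :=
    Measurable.stronglyMeasurable (by fun_prop)
  rw [funext (hw.smoothGrad_eq_integral_gradKernel u)]
  exact h.integral_prod_right.aestronglyMeasurable

lemma IsCutoff.aestronglyMeasurable_adjointGrad (hw : IsCutoff δ w) (hΦ : Continuous Φ) :
    AEStronglyMeasurable (adjointGrad s w Φ) := by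
  have hk := hw.measurable_gradKernel (s := s)
  have h : StronglyMeasurable fun q : EuclideanSpace ℝ (Fin n) × EuclideanSpace ℝ (Fin n) =>
      (Φ q.1 - Φ (q.1 + q.2)) • gradKernel s w q.2 :=
    Measurable.stronglyMeasurable (by fun_prop)
  exact h.integral_prod_right.aestronglyMeasurable

/-- Nonlocal integration by parts. -/
lemma IsCutoff.integral_smul_smoothGrad (hw : IsCutoff δ w) (hn : 1 ≤ n) (hs0 : 0 < s)
    (hs1 : s < 1) (hu : ContDiff ℝ 1 u) (hus : HasCompactSupport u)
    (hΦ : ContDiff ℝ 1 Φ) (hΦs : HasCompactSupport Φ) :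
    ∫ x, Φ x • smoothGrad s δ w u x = ∫ x, u x • adjointGrad s w Φ x := by
  obtain ⟨Lu, hLu⟩ := hu.lipschitzWith_of_hasCompactSupport hus one_ne_zero
  obtain ⟨LΦ, hLΦ⟩ := hΦ.lipschitzWith_of_hasCompactSupport hΦs one_ne_zero
  have hk := hw.measurable_gradKernel (s := s)
  have huc := hu.continuous
  have hΦc := hΦ.continuous
  have hb : Integrable fun z => ((n : ℝ) - 1 + s) * rho s w z :=
    (hw.integrable_rho hn hs0 hs1).const_mul _
  have h1 : Integrable (Function.uncurry fun x z : EuclideanSpace ℝ (Fin n) =>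
      Φ x • (u x - u (x - z)) • gradKernel s w z) (volume.prod volume) := by
    refine ((hΦc.integrable_of_hasCompactSupport hΦs).norm.mul_prod (hb.const_mul (Lu : ℝ))).mono'
      (Measurable.aestronglyMeasurable ?_) (Eventually.of_forall fun q => ?_)
    · change Measurable fun q : EuclideanSpace ℝ (Fin n) × EuclideanSpace ℝ (Fin n) =>
        Φ q.1 • (u q.1 - u (q.1 - q.2)) • gradKernel s w q.2
      fun_prop
    · simp only [Function.uncurry]
      rw [norm_smul]
      gcongr
      exact hw.norm_sub_smul_gradKernel_le hn hs0 hs1 hLu _ _ _ (by simp)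
  have h2 : Integrable (Function.uncurry fun x z : EuclideanSpace ℝ (Fin n) =>
      u x • (Φ x - Φ (x + z)) • gradKernel s w z) (volume.prod volume) := by
    refine ((huc.integrable_of_hasCompactSupport hus).norm.mul_prod (hb.const_mul (LΦ : ℝ))).mono'
      (Measurable.aestronglyMeasurable ?_) (Eventually.of_forall fun q => ?_)
    · change Measurable fun q : EuclideanSpace ℝ (Fin n) × EuclideanSpace ℝ (Fin n) =>
        u q.1 • (Φ q.1 - Φ (q.1 + q.2)) • gradKernel s w q.2
      fun_prop
    · simp only [Function.uncurry]
      rw [norm_smul]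
      gcongr
      exact hw.norm_sub_smul_gradKernel_le hn hs0 hs1 hLΦ _ _ _ (by simp)
  simp_rw [hw.smoothGrad_eq_integral_gradKernel, adjointGrad, ← integral_smul]
  rw [integral_integral_swap h1, integral_integral_swap h2]
  refine integral_congr_ae (Eventually.of_forall fun z => ?_)
  simp only [smul_smul]
  rw [integral_smul_const, integral_smul_const]
  congr 1
  have i1 : Integrable fun x => Φ x * u x :=
    (hΦc.mul huc).integrable_of_hasCompactSupport hΦs.mul_right
  have i2 : Integrable fun x => Φ x * u (x - z) :=
    (hΦc.mul (by fun_prop)).integrable_of_hasCompactSupport hΦs.mul_right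
  have i3 : Integrable fun x => u x * Φ (x + z) :=
    (huc.mul (by fun_prop)).integrable_of_hasCompactSupport hus.mul_right
  -- For fixed `z` the terms `Φ u` agree, and shifting `x` by `z` matches `Φ(x) u(x - z)` with `Φ(x
  -- + z) u(x)`.
  simp only [mul_sub]
  rw [integral_sub i1 i2, integral_sub (by simpa only [mul_comm] using i1) i3,
    ← integral_add_right_eq_self (fun x => Φ x * u (x - z)) z]
  simp only [add_sub_cancel_right, mul_comm]

lemma isOpen_enlarge (Ω : Set (EuclideanSpace ℝ (Fin n))) : IsOpen (enlarge δ Ω) :=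
  Metric.isOpen_ball.add_left

lemma add_mem_enlarge {Ω : Set (EuclideanSpace ℝ (Fin n))} {x z : EuclideanSpace ℝ (Fin n)}
    (hx : x ∈ Ω) (hz : ‖z‖ < δ) : x + z ∈ enlarge δ Ω :=
  Set.add_mem_add hx (by simpa using hz)

variable {Ω : Set (EuclideanSpace ℝ (Fin n))}

lemma subset_enlarge (hδ : 0 < δ) : Ω ⊆ enlarge δ Ω := fun x hx => by
  simpa using add_mem_enlarge (z := 0) hx (by simpa using hδ)

/-- If `Φ (x + z) ≠ 0` with `|z| < δ`, then `x ∈ Ω + B(0, δ)`. Hence the weak formulation sees `u`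
only on `Ω_δ`. -/
lemma IsCutoff.adjointGrad_eq_zero (hw : IsCutoff δ w) (hδ : 0 < δ) (hΦ : tsupport Φ ⊆ Ω)
    {x : EuclideanSpace ℝ (Fin n)} (hx : x ∉ enlarge δ Ω) : adjointGrad s w Φ x = 0 := by
  refine integral_eq_zero_of_ae (Eventually.of_forall fun z => ?_)
  by_cases hz : z ∈ Metric.ball (0 : EuclideanSpace ℝ (Fin n)) δ
  · have h1 : Φ x = 0 :=
      image_eq_zero_of_notMem_tsupport fun h => hx (subset_enlarge hδ (hΦ h))
    have h2 : Φ (x + z) = 0 := image_eq_zero_of_notMem_tsupport fun h => hx (by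
      simpa using add_mem_enlarge (δ := δ) (z := -z) (hΦ h) (by simpa using hz))
    simp [h1, h2]
  · simp [hw.gradKernel_eq_zero hz]

variable {V V₁ V₂ : EuclideanSpace ℝ (Fin n) → EuclideanSpace ℝ (Fin n)}

/-- The nonlocal gradient satisfies the weak formulation against test functions in `Ω`. -/
lemma IsNonlocalGrad.integral_smul_eq (hw : IsCutoff δ w) (hn : 1 ≤ n) (hs0 : 0 < s)
    (hs1 : s < 1) (hδ : 0 < δ) (hV : IsNonlocalGrad s δ w Ω u V)
    (hΦ : ContDiff ℝ ∞ Φ) (hΦs : HasCompactSupport Φ) (hΦΩ : tsupport Φ ⊆ Ω) :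
    ∫ x in Ω, Φ x • V x = ∫ x in enlarge δ Ω, u x • adjointGrad s w Φ x := by
  obtain ⟨hu, hVm, φ, hφ, hφu, hφV⟩ := hV
  obtain ⟨C, hC⟩ := hΦs.exists_bound_of_continuous hΦ.continuous
  have hΦ1 : ContDiff ℝ 1 Φ := hΦ.of_le (by simp)
  obtain ⟨L, hL⟩ := hΦ1.lipschitzWith_of_hasCompactSupport hΦs one_ne_zero
  have hA := hw.norm_adjointGrad_le hn hs0 hs1 hL
  have hAm := hw.aestronglyMeasurable_adjointGrad (s := s) hΦ.continuous
  have l1 : Tendsto (fun j => ∫ x in Ω, Φ x • smoothGrad s δ w (φ j) x) atTop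
      (𝓝 (∫ x in Ω, Φ x • V x)) := by
    refine tendsto_integral_of_tendsto_eLpNorm_sub (C := C) (fun j => ?_) ?_ (fun j x => ?_) hφV
    · exact hΦ.continuous.aestronglyMeasurable.smul
        (hw.aestronglyMeasurable_smoothGrad (hφ j).1.continuous).restrict
    · exact (memLp_one_iff_integrable.1 hVm).bdd_smul C hΦ.continuous.aestronglyMeasurable
        (Eventually.of_forall hC)
    · rw [← smul_sub, norm_smul]
      gcongr
      exact hC x
  have l2 : Tendsto (fun j => ∫ x in enlarge δ Ω, φ j x • adjointGrad s w Φ x) atTop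
      (𝓝 (∫ x in enlarge δ Ω, u x • adjointGrad s w Φ x)) := by
    refine tendsto_integral_of_tendsto_eLpNorm_sub
      (C := ∫ z, L * (((n : ℝ) - 1 + s) * rho s w z)) (fun j => ?_) ?_ (fun j x => ?_) hφu
    · exact (hφ j).1.continuous.aestronglyMeasurable.smul hAm.restrict
    · exact (memLp_one_iff_integrable.1 hu).smul_bdd _ hAm.restrict (Eventually.of_forall hA)
    · rw [← sub_smul, norm_smul, mul_comm]
      gcongr
      exact hA x
  refine tendsto_nhds_unique l1 (l2.congr fun j => ?_)
  rw [setIntegral_eq_integral_of_forall_compl_eq_zero fun x hx => by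
      rw [hw.adjointGrad_eq_zero hδ hΦΩ hx, smul_zero],
    setIntegral_eq_integral_of_forall_compl_eq_zero fun x hx => by
      rw [image_eq_zero_of_notMem_tsupport fun h => hx (hΦΩ h), zero_smul],
    hw.integral_smul_smoothGrad hn hs0 hs1 ((hφ j).1.of_le (by simp)) (hφ j).2 hΦ1 hΦs]

/-- The weak formulation has a right-hand side free of `V`, so `V₁ - V₂` is orthogonal to all test
functions in `Ω`. -/
lemma IsNonlocalGrad.ae_eq (hw : IsCutoff δ w) (hn : 1 ≤ n) (hs0 : 0 < s)
    (hs1 : s < 1) (hδ : 0 < δ) (hΩ : IsOpen Ω) (h₁ : IsNonlocalGrad s δ w Ω u V₁)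
    (h₂ : IsNonlocalGrad s δ w Ω u V₂) : V₁ =ᵐ[volume.restrict Ω] V₂ := by
  have i₁ : IntegrableOn V₁ Ω := memLp_one_iff_integrable.1 h₁.2.1
  have i₂ : IntegrableOn V₂ Ω := memLp_one_iff_integrable.1 h₂.2.1
  have key := hΩ.ae_eq_zero_of_integral_contDiff_smul_eq_zero (μ := volume)
    (f := fun x => V₁ x - V₂ x) (i₁.sub i₂).locallyIntegrableOn (fun Φ hΦ hΦs hΦΩ => ?_)
  · rw [EventuallyEq, ae_restrict_iff' hΩ.measurableSet]
    filter_upwards [key] with x hx hxΩ using sub_eq_zero.1 (hx hxΩ)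
  · obtain ⟨C, hC⟩ := hΦs.exists_bound_of_continuous hΦ.continuous
    rw [← setIntegral_eq_integral_of_forall_compl_eq_zero (s := Ω) fun x hx => by
      rw [image_eq_zero_of_notMem_tsupport fun h => hx (hΦΩ h), zero_smul]]
    have j₁ : IntegrableOn (fun x => Φ x • V₁ x) Ω :=
      i₁.bdd_smul C hΦ.continuous.aestronglyMeasurable (Eventually.of_forall hC)
    have j₂ : IntegrableOn (fun x => Φ x • V₂ x) Ω :=
      i₂.bdd_smul C hΦ.continuous.aestronglyMeasurable (Eventually.of_forall hC)
    simp only [smul_sub]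
    rw [integral_sub j₁ j₂, h₁.integral_smul_eq hw hn hs0 hs1 hδ hΦ hΦs hΦΩ,
      h₂.integral_smul_eq hw hn hs0 hs1 hδ hΦ hΦs hΦΩ, sub_self]

end NonlocalGradient
end

/-! ### Sobolev functions and the embeddings. -/

noncomputable section

namespace NonlocalGradient

open ContinuousLinearMap (lsmul)
open scoped Convolution

variable {n : ℕ} {s δ : ℝ} {w : EuclideanSpace ℝ (Fin n) → ℝ} {p q : ℝ≥0∞}
  {Ω U : Set (EuclideanSpace ℝ (Fin n))} {u : EuclideanSpace ℝ (Fin n) → ℝ}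
  {G V : EuclideanSpace ℝ (Fin n) → EuclideanSpace ℝ (Fin n)}

lemma MemW.mono_exponent (h : MemW q U u G) (hpq : p ≤ q) (hU : volume U ≠ ⊤) :
    MemW p U u G := by
  have : IsFiniteMeasure (volume.restrict U) := ⟨by simpa using hU.lt_top⟩
  exact ⟨h.1.mono_exponent hpq, h.2.1.mono_exponent hpq, h.2.2⟩

/-- Away from the boundary, mollification commutes with the weak gradient. -/
lemma MemW.fderiv_normed_convolution (h : MemW 1 U u G) (hU : IsOpen U)
    (φ : ContDiffBump (0 : EuclideanSpace ℝ (Fin n))) {x : EuclideanSpace ℝ (Fin n)}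
    (hx : Metric.closedBall x φ.rOut ⊆ U) (v : EuclideanSpace ℝ (Fin n)) :
    fderiv ℝ (φ.normed volume ⋆[lsmul ℝ ℝ, volume] U.indicator u) x v =
      ⟪(φ.normed volume ⋆[lsmul ℝ ℝ, volume] U.indicator G) x, v⟫_ℝ := by
  set η := φ.normed (volume : Measure (EuclideanSpace ℝ (Fin n)))
  have hη : ContDiff ℝ ∞ η := φ.contDiff_normed
  have hη1 : ContDiff ℝ 1 η := φ.contDiff_normed
  have hηs : HasCompactSupport η := φ.hasCompactSupport_normed
  have hu : Integrable (U.indicator u) :=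
    (integrable_indicator_iff hU.measurableSet).2 (memLp_one_iff_integrable.1 h.1)
  have hG : Integrable (U.indicator G) :=
    (integrable_indicator_iff hU.measurableSet).2 (memLp_one_iff_integrable.1 h.2.1)
  -- This reflected bump, supported in `U`, is the test function for the weak gradient; the sign
  -- from the chain rule cancels the one from integration by parts.
  set ψ : EuclideanSpace ℝ (Fin n) → ℝ := fun y => η (x - y)
  have hψ : ContDiff ℝ ∞ ψ := hη.comp (contDiff_const.sub contDiff_id)
  have hψsupp : tsupport ψ ⊆ Metric.closedBall x φ.rOut := by
    refine closure_minimal (fun y hy => ?_) Metric.isClosed_closedBall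
    have h1 : x - y ∈ Metric.ball (0 : EuclideanSpace ℝ (Fin n)) φ.rOut := by
      rw [← φ.support_normed_eq (μ := volume)]
      exact hy
    rw [mem_ball_zero_iff] at h1
    rw [Metric.mem_closedBall, dist_comm, dist_eq_norm]
    exact h1.le
  have hψs : HasCompactSupport ψ :=
    (isCompact_closedBall x φ.rOut).of_isClosed_subset (isClosed_tsupport _) hψsupp
  have hψd : ∀ y, fderiv ℝ ψ y v = -fderiv ℝ η (x - y) v := by
    intro y
    have h1 : HasFDerivAt (fun y => x - y) (-ContinuousLinearMap.id ℝ (EuclideanSpace ℝ (Fin n))) y :=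
      (hasFDerivAt_id y).const_sub x
    have h2 : HasFDerivAt ψ _ y :=
      ((hη1.differentiable one_ne_zero).differentiableAt.hasFDerivAt (x := x - y)).comp y h1
    rw [h2.fderiv]
    simp
  have hexu := (hηs.fderiv ℝ).convolutionExists_left
    ((lsmul ℝ ℝ).precompL (EuclideanSpace ℝ (Fin n)) :
      (EuclideanSpace ℝ (Fin n) →L[ℝ] ℝ) →L[ℝ] ℝ →L[ℝ] EuclideanSpace ℝ (Fin n) →L[ℝ] ℝ)
    (hη1.continuous_fderiv one_ne_zero) hu.locallyIntegrable x
  have hexG := hηs.convolutionExists_left (lsmul ℝ ℝ) hη.continuous hG.locallyIntegrable x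
  rw [(hηs.hasFDerivAt_convolution_left (lsmul ℝ ℝ) hη1 hu.locallyIntegrable x).fderiv,
    convolution_eq_swap, convolution_eq_swap,
    ContinuousLinearMap.integral_apply hexu.integrable_swap, real_inner_comm,
    ← integral_inner hexG.integrable_swap]
  have e1 : ∫ y, ((lsmul ℝ ℝ).precompL (EuclideanSpace ℝ (Fin n)) (fderiv ℝ η (x - y)))
      (U.indicator u y) v = - ∫ y in U, u y * fderiv ℝ ψ y v := by
    rw [← integral_indicator hU.measurableSet, ← integral_neg]
    refine integral_congr_ae (Eventually.of_forall fun y => ?_)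
    by_cases hy : y ∈ U
    · simp [hy, hψd, mul_comm]
    · simp [hy]
  have e2 : ∫ y, ⟪v, (lsmul ℝ ℝ (η (x - y))) (U.indicator G y)⟫_ℝ =
      ∫ y in U, ⟪G y, v⟫_ℝ * ψ y := by
    rw [← integral_indicator hU.measurableSet]
    refine integral_congr_ae (Eventually.of_forall fun y => ?_)
    by_cases hy : y ∈ U
    · simp [hy, ψ, inner_smul_right, real_inner_comm, mul_comm]
    · simp [hy]
  rw [e1, e2, h.2.2 ψ hψ hψs (hψsupp.trans hx) v, neg_neg]

/-- Segments `[x - z, x]` with `x ∈ Ω`, `w z ≠ 0` stay uniformly inside `Ω_δ`. -/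
lemma IsCutoff.exists_closedBall_subset_enlarge (hw : IsCutoff δ w) :
    ∃ ε : ℝ, 0 < ε ∧ ∀ x ∈ Ω, ∀ z, w z ≠ 0 → ∀ t ∈ Set.Icc (0 : ℝ) 1,
      Metric.closedBall (x - t • z) ε ⊆ enlarge δ Ω := by
  -- A closed set inside an open ball lies in a smaller concentric ball; `δ - r` is the margin.
  obtain ⟨r, hr, hwr⟩ := exists_lt_subset_ball (isClosed_tsupport w) hw.tsupport_subset
  refine ⟨δ - r, sub_pos.2 hr, fun x hx z hz t ht y hy => ?_⟩
  have hzr : ‖z‖ < r := by simpa using hwr (subset_tsupport w hz)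
  have h1 : ‖t • z‖ ≤ ‖z‖ := by
    rw [norm_smul, Real.norm_of_nonneg ht.1]
    exact mul_le_of_le_one_left (norm_nonneg z) ht.2
  rw [Metric.mem_closedBall, dist_eq_norm] at hy
  have h2 : ‖y - x‖ < δ := by
    calc ‖y - x‖ = ‖(y - (x - t • z)) - t • z‖ := by congr 1; abel
      _ ≤ ‖y - (x - t • z)‖ + ‖t • z‖ := norm_sub_le _ _
      _ < δ := by linarith
  simpa using add_mem_enlarge hx h2

lemma isBounded_enlarge (hΩ : Bornology.IsBounded Ω) : Bornology.IsBounded (enlarge δ Ω) :=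
  hΩ.add Metric.isBounded_ball

/-- Functions in `W^{1,p}(Ω_δ)` are limits of their mollifications in `H^{s,p,δ}(Ω)`. -/
lemma MemW.isSmoothLimit (h : MemW p (enlarge δ Ω) u G) (hw : IsCutoff δ w) (hn : 1 ≤ n)
    (hs0 : 0 < s) (hs1 : s < 1) (hΩ : IsOpen Ω) (hΩb : Bornology.IsBounded Ω)
    (hp : 1 ≤ p) (hpt : p ≠ ⊤) :
    IsSmoothLimit s δ w Ω p u (segmentAverage s w ((enlarge δ Ω).indicator G)) := by
  have := hw.isFiniteMeasure_segmentMeasure hn hs0 hs1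
  set U := enlarge δ Ω
  have hU : IsOpen U := isOpen_enlarge Ω
  have hUb : Bornology.IsBounded U := isBounded_enlarge hΩb
  have h1 : MemW 1 U u G := h.mono_exponent hp hUb.measure_lt_top.ne
  set u₀ := U.indicator u
  set G₀ := U.indicator G
  have hu₀ : MemLp u₀ p := (memLp_indicator_iff_restrict hU.measurableSet).2 h.1
  have hG₀ : MemLp G₀ p := (memLp_indicator_iff_restrict hU.measurableSet).2 h.2.1
  have hu₁ : Integrable u₀ :=
    (integrable_indicator_iff hU.measurableSet).2 (memLp_one_iff_integrable.1 h1.1)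
  have hG₁ : Integrable G₀ :=
    (integrable_indicator_iff hU.measurableSet).2 (memLp_one_iff_integrable.1 h1.2.1)
  have hu₀s : HasCompactSupport u₀ := by
    refine HasCompactSupport.of_support_subset_isCompact hUb.isCompact_closure ?_
    exact (Set.support_indicator_subset).trans subset_closure
  have hVle := eLpNorm_segmentAverage_le (s := s) (w := w) hG₀.1 hp
  have hVp : MemLp (segmentAverage s w G₀) p :=
    ⟨aestronglyMeasurable_segmentAverage hG₀.1,
      hVle.trans_lt (ENNReal.mul_lt_top (measure_lt_top _ _) hG₀.2)⟩
  refine ⟨h.1, hVp.restrict Ω, ?_⟩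
  let φ : ℕ → ContDiffBump (0 : EuclideanSpace ℝ (Fin n)) := fun i =>
    ⟨1 / ((i : ℝ) + 1 + 1), 1 / ((i : ℝ) + 1), by positivity, by gcongr; linarith⟩
  have hφ : Tendsto (fun i => (φ i).rOut) atTop (𝓝 0) := tendsto_one_div_add_atTop_nhds_zero_nat
  set f : ℕ → EuclideanSpace ℝ (Fin n) → ℝ := fun i =>
    (φ i).normed volume ⋆[lsmul ℝ ℝ, volume] u₀
  have hf : ∀ i, ContDiff ℝ ∞ (f i) := fun i =>
    (φ i).hasCompactSupport_normed.contDiff_convolution_left _ (φ i).contDiff_normed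
      hu₁.locallyIntegrable
  have hfs : ∀ i, HasCompactSupport (f i) := fun i =>
    (φ i).hasCompactSupport_normed.convolution _ hu₀s
  refine ⟨f, fun i => ⟨hf i, hfs i⟩, ?_, ?_⟩
  · refine tendsto_of_tendsto_of_tendsto_of_le_of_le tendsto_const_nhds
      (tendsto_eLpNorm_normed_convolution_sub hφ hu₀ hu₁.locallyIntegrable hp hpt)
      (fun _ => zero_le) (fun i => ?_)
    have : eLpNorm (f i - u) p (volume.restrict U) = eLpNorm (f i - u₀) p (volume.restrict U) := by
      refine eLpNorm_congr_ae ?_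
      filter_upwards [ae_restrict_mem hU.measurableSet] with x hx
      simp [u₀, hx]
    rw [this]
    exact eLpNorm_mono_measure _ Measure.restrict_le_self
  · obtain ⟨ε, hε, hεU⟩ := hw.exists_closedBall_subset_enlarge (Ω := Ω)
    have hlim : Tendsto (fun i => segmentMeasure s w Set.univ *
        eLpNorm (((φ i).normed volume ⋆[lsmul ℝ ℝ, volume] G₀) - G₀) p volume) atTop (𝓝 0) := by
      simpa using ENNReal.Tendsto.const_mul
        (tendsto_eLpNorm_normed_convolution_sub hφ hG₀ hG₁.locallyIntegrable hp hpt)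
        (Or.inr (measure_ne_top (segmentMeasure s w) Set.univ))
    refine tendsto_of_tendsto_of_tendsto_of_le_of_le' tendsto_const_nhds hlim
      (Eventually.of_forall fun _ => zero_le) ?_
    -- Once the radius is below the margin `ε`, mollification and gradient commute on every relevant
    -- segment.
    filter_upwards [hφ.eventually_lt_const hε] with i hi
    set Gi := (φ i).normed volume ⋆[lsmul ℝ ℝ, volume] G₀
    have hGi : Integrable Gi := (φ i).integrable_normed.integrable_convolution _ hG₁
    have hsg : ∀ x ∈ Ω, smoothGrad s δ w (f i) x = segmentAverage s w Gi x := fun x hx =>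
      hw.smoothGrad_eq_segmentAverage hn hs0 hs1 ((hf i).of_le (by simp)) (hfs i)
        fun z hz t ht v => h1.fderiv_normed_convolution hU (φ i)
          ((Metric.closedBall_subset_closedBall hi.le).trans (hεU x hx z hz t ht)) v
    calc eLpNorm (smoothGrad s δ w (f i) - segmentAverage s w G₀) p (volume.restrict Ω)
        = eLpNorm (segmentAverage s w Gi - segmentAverage s w G₀) p (volume.restrict Ω) := by
          refine eLpNorm_congr_ae ?_
          filter_upwards [ae_restrict_mem hΩ.measurableSet] with x hx
          simp [hsg x hx]
      _ ≤ eLpNorm (segmentAverage s w Gi - segmentAverage s w G₀) p volume :=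
          eLpNorm_mono_measure _ Measure.restrict_le_self
      _ = eLpNorm (segmentAverage s w (Gi - G₀)) p volume :=
          eLpNorm_congr_ae (segmentAverage_sub_ae hGi hG₁).symm
      _ ≤ _ := eLpNorm_segmentAverage_le (hGi.1.sub hG₁.1) hp

/-- Only `L¹` approximation is needed, so `p = ∞` is included. -/
lemma MemW.isNonlocalGrad (h : MemW p (enlarge δ Ω) u G) (hw : IsCutoff δ w) (hn : 1 ≤ n)
    (hs0 : 0 < s) (hs1 : s < 1) (hΩ : IsOpen Ω) (hΩb : Bornology.IsBounded Ω) (hp : 1 ≤ p) :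
    IsNonlocalGrad s δ w Ω u (segmentAverage s w ((enlarge δ Ω).indicator G)) :=
  (h.mono_exponent hp (isBounded_enlarge hΩb).measure_lt_top.ne).isSmoothLimit hw hn hs0 hs1 hΩ
    hΩb le_rfl ENNReal.one_ne_top

/-- The nonlocal gradient is bounded in `L^p(Ω)` by the gradient in `L^p(Ω_δ)`, `1 ≤ p ≤ ∞`. -/
lemma MemW.eLpNorm_nonlocalGrad_le (h : MemW p (enlarge δ Ω) u G) (hw : IsCutoff δ w)
    (hn : 1 ≤ n) (hs0 : 0 < s) (hs1 : s < 1) (hδ : 0 < δ) (hΩ : IsOpen Ω)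
    (hΩb : Bornology.IsBounded Ω) (hp : 1 ≤ p) (hV : IsNonlocalGrad s δ w Ω u V) :
    eLpNorm V p (volume.restrict Ω) ≤
      ENNReal.ofReal ((n : ℝ) - 1 + s) * eLpNorm (rho s w) 1 volume *
        eLpNorm G p (volume.restrict (enlarge δ Ω)) := by
  have := hw.isFiniteMeasure_segmentMeasure hn hs0 hs1
  have hU : MeasurableSet (enlarge δ Ω) := (isOpen_enlarge Ω).measurableSet
  have hG := (memLp_indicator_iff_restrict hU).2 h.2.1
  rw [eLpNorm_congr_ae (hV.ae_eq hw hn hs0 hs1 hδ hΩ (h.isNonlocalGrad hw hn hs0 hs1 hΩ hΩb hp)),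
    ← hw.segmentMeasure_univ hn hs0 hs1, ← eLpNorm_indicator_eq_eLpNorm_restrict hU]
  exact (eLpNorm_mono_measure _ Measure.restrict_le_self).trans (eLpNorm_segmentAverage_le hG.1 hp)

lemma rpow_add_rpow_le_mul {a b c d M : ℝ≥0∞} {r : ℝ} (hr : 0 < r) (ha : a ≤ M * c)
    (hb : b ≤ M * d) :
    (a ^ r + b ^ r) ^ (1 / r) ≤ M * (c ^ r + d ^ r) ^ (1 / r) := by
  calc (a ^ r + b ^ r) ^ (1 / r) ≤ ((M * c) ^ r + (M * d) ^ r) ^ (1 / r) := by gcongr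
    _ = (M ^ r * (c ^ r + d ^ r)) ^ (1 / r) := by
        rw [ENNReal.mul_rpow_of_nonneg _ _ hr.le, ENNReal.mul_rpow_of_nonneg _ _ hr.le, mul_add]
    _ = _ := by
        rw [ENNReal.mul_rpow_of_nonneg _ _ (by positivity), ← ENNReal.rpow_mul,
          mul_one_div_cancel hr.ne', ENNReal.rpow_one]

lemma exists_hNorm_le_mul_wNorm (hw : IsCutoff δ w)
    (hn : 1 ≤ n) (hs0 : 0 < s) (hs1 : s < 1) (hδ : 0 < δ) (hΩ : IsOpen Ω)
    (hΩb : Bornology.IsBounded Ω) (hp : 1 ≤ p) (hpt : p ≠ ⊤) :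
    ∃ C : ℝ≥0, ∀ u G, MemW p (enlarge δ Ω) u G → ∀ V, IsNonlocalGrad s δ w Ω u V →
      hNorm δ Ω p u V ≤ C * wNorm p (enlarge δ Ω) u G := by
  have := hw.isFiniteMeasure_segmentMeasure hn hs0 hs1
  obtain ⟨M, hM⟩ : ∃ M : ℝ≥0, (M : ℝ≥0∞) = segmentMeasure s w Set.univ :=
    ⟨_, ENNReal.coe_toNNReal (measure_ne_top _ _)⟩
  have hp0 : 0 < p.toReal := ENNReal.toReal_pos (zero_lt_one.trans_le hp).ne' hpt
  -- The `1` serves the `u` term, which is the same in both norms; `M` serves the gradient term.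
  refine ⟨max 1 M, fun u G h V hV => ?_⟩
  rw [hNorm, wNorm, if_neg hpt]
  refine rpow_add_rpow_le_mul hp0 ?_ ?_
  · exact le_mul_of_one_le_left zero_le (by exact_mod_cast le_max_left 1 M)
  · refine (h.eLpNorm_nonlocalGrad_le hw hn hs0 hs1 hδ hΩ hΩb hp hV).trans ?_
    rw [← hw.segmentMeasure_univ hn hs0 hs1, ← hM]
    gcongr
    exact le_max_right 1 M

lemma exists_wNorm_le_mul_wNorm_top (hU : volume U ≠ ⊤) (hp : 1 ≤ p) (hpt : p ≠ ⊤) :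
    ∃ C : ℝ≥0, ∀ u G, MemW ⊤ U u G → wNorm p U u G ≤ C * wNorm ⊤ U u G := by
  have hp0 : 0 < p.toReal := ENNReal.toReal_pos (zero_lt_one.trans_le hp).ne' hpt
  obtain ⟨κ, hκ⟩ : ∃ κ : ℝ≥0, (κ : ℝ≥0∞) = volume U ^ (1 / p.toReal) :=
    ⟨_, ENNReal.coe_toNNReal (ENNReal.rpow_ne_top_of_nonneg (by positivity) hU)⟩
  -- `κ` is Hölder's factor on a set of finite measure; `2 ^ (1/p)` comes from bounding both terms
  -- by their maximum.
  refine ⟨κ * 2 ^ (1 / p.toReal), fun u G h => ?_⟩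
  rw [wNorm, wNorm, if_neg hpt, if_pos rfl]
  set m := max (eLpNorm u ⊤ (volume.restrict U)) (eLpNorm G ⊤ (volume.restrict U))
  have hle : ∀ {F : Type} [NormedAddCommGroup F] {f : EuclideanSpace ℝ (Fin n) → F},
      MemLp f ⊤ (volume.restrict U) → eLpNorm f ⊤ (volume.restrict U) ≤ m →
      eLpNorm f p (volume.restrict U) ≤ κ * m := by
    intro F _ f hf hfm
    refine (eLpNorm_le_eLpNorm_mul_rpow_measure_univ le_top hf.1).trans ?_
    rw [Measure.restrict_apply_univ, ENNReal.toReal_top, div_zero, sub_zero, ← hκ, mul_comm]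
    gcongr
  refine (rpow_add_rpow_le_mul hp0 (hle h.1 (le_max_left _ _)) (hle h.2.1 (le_max_right _ _))).trans
    (le_of_eq ?_)
  rw [← two_mul, ENNReal.mul_rpow_of_nonneg _ _ (by positivity), ← ENNReal.rpow_mul,
    mul_one_div_cancel hp0.ne', ENNReal.rpow_one, ENNReal.coe_mul,
    ENNReal.coe_rpow_of_nonneg _ (by positivity), ENNReal.coe_ofNat, mul_assoc]

end NonlocalGradient
end

theorem lemma2p1 (n : ℕ) (hn : 1 ≤ n) (s : ℝ) (hs0 : 0 < s) (hs1 : s < 1) (δ : ℝ) (hδ : 0 < δ)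
    (w : EuclideanSpace ℝ (Fin n) → ℝ) (hw : NonlocalGradient.IsCutoff δ w)
    (Ω : Set (EuclideanSpace ℝ (Fin n))) (hΩo : IsOpen Ω) (hΩne : Ω.Nonempty)
    (hΩb : Bornology.IsBounded Ω)
    (hLip : NonlocalGradient.HasLipschitzBoundary (NonlocalGradient.enlarge δ Ω)) :
    -- a) the case `1 ≤ p < ∞`
    (∀ p : ℝ≥0∞, 1 ≤ p → p ≠ ⊤ →
      (∃ C : ℝ≥0, ∀ u G, NonlocalGradient.MemW p (NonlocalGradient.enlarge δ Ω) u G →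
        NonlocalGradient.MemH s δ w Ω p u ∧
        (∃ V, NonlocalGradient.IsNonlocalGrad s δ w Ω u V) ∧
        ∀ V, NonlocalGradient.IsNonlocalGrad s δ w Ω u V →
          NonlocalGradient.hNorm δ Ω p u V ≤
            C * NonlocalGradient.wNorm p (NonlocalGradient.enlarge δ Ω) u G) ∧
      (∀ u G, NonlocalGradient.MemW p (NonlocalGradient.enlarge δ Ω) u G →
        ∀ V, NonlocalGradient.IsNonlocalGrad s δ w Ω u V →
          eLpNorm V p (volume.restrict Ω) ≤
            ENNReal.ofReal ((n : ℝ) - 1 + s) * eLpNorm (NonlocalGradient.rho s w) 1 volume *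
              eLpNorm G p (volume.restrict (NonlocalGradient.enlarge δ Ω)))) ∧
    -- b) the case `W^{1,∞}`
    (∀ p : ℝ≥0∞, 1 ≤ p → p ≠ ⊤ →
      ∃ C : ℝ≥0, ∀ u G, NonlocalGradient.MemW ⊤ (NonlocalGradient.enlarge δ Ω) u G →
        NonlocalGradient.MemH s δ w Ω p u ∧
        (∃ V, NonlocalGradient.IsNonlocalGrad s δ w Ω u V) ∧
        ∀ V, NonlocalGradient.IsNonlocalGrad s δ w Ω u V →
          NonlocalGradient.hNorm δ Ω p u V ≤
            C * NonlocalGradient.wNorm ⊤ (NonlocalGradient.enlarge δ Ω) u G) ∧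
    (∀ u G, NonlocalGradient.MemW ⊤ (NonlocalGradient.enlarge δ Ω) u G →
      ∀ V, NonlocalGradient.IsNonlocalGrad s δ w Ω u V →
        eLpNorm V ⊤ (volume.restrict Ω) ≤
          ENNReal.ofReal ((n : ℝ) - 1 + s) * eLpNorm (NonlocalGradient.rho s w) 1 volume *
            eLpNorm G ⊤ (volume.restrict (NonlocalGradient.enlarge δ Ω))) := by
  have hU : volume (NonlocalGradient.enlarge δ Ω) ≠ ⊤ :=
    (NonlocalGradient.isBounded_enlarge hΩb).measure_lt_top.ne
  refine ⟨fun p hp hpt => ⟨?_, fun u G h V hV =>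
      h.eLpNorm_nonlocalGrad_le hw hn hs0 hs1 hδ hΩo hΩb hp hV⟩,
    fun p hp hpt => ?_, fun u G h V hV =>
      h.eLpNorm_nonlocalGrad_le hw hn hs0 hs1 hδ hΩo hΩb le_top hV⟩
  · obtain ⟨C, hC⟩ :=
      NonlocalGradient.exists_hNorm_le_mul_wNorm hw hn hs0 hs1 hδ hΩo hΩb hp hpt
    exact ⟨C, fun u G h => ⟨⟨_, h.isSmoothLimit hw hn hs0 hs1 hΩo hΩb hp hpt⟩,
      ⟨_, h.isNonlocalGrad hw hn hs0 hs1 hΩo hΩb hp⟩, hC u G h⟩⟩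
  · obtain ⟨C, hC⟩ :=
      NonlocalGradient.exists_hNorm_le_mul_wNorm hw hn hs0 hs1 hδ hΩo hΩb hp hpt
    obtain ⟨C', hC'⟩ := NonlocalGradient.exists_wNorm_le_mul_wNorm_top hU hp hpt
    refine ⟨C * C', fun u G h => ?_⟩
    -- `Ω_δ` has finite measure, so the `W^{1,∞}` embedding factors through `W^{1,p}`.
    have hp' := h.mono_exponent (p := p) le_top hU
    refine ⟨⟨_, hp'.isSmoothLimit hw hn hs0 hs1 hΩo hΩb hp hpt⟩,
      ⟨_, h.isNonlocalGrad hw hn hs0 hs1 hΩo hΩb le_top⟩, fun V hV => ?_⟩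
    refine (hC u G hp' V hV).trans ?_
    rw [ENNReal.coe_mul, mul_assoc]
    gcongr
    exact hC' u G h
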